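/- Let $p$ be a prime and let $\mathcal A_p$ be the set of isomorphism classes of finite abelian $p$-groups. Every $G\in\mathcal A_p$ is a direct product of cyclic groups of orders $p^{\lambda_1},p^{\lambda_2},\dots$ for a unique sequence of integers $\lambda_1\ge\lambda_2\ge\dots\ge 0$ with only finitely many non-zero terms (factors of order $p^0=1$ are trivial). For $m\ge 1$ let $\mathcal A_{p,m}\subseteq\mathcal A_p$ be the set of those $G$ for which the first $m$ cyclic factors, of orders $p^{\lambda_1},\dots,p^{\lambda_m}$, are isomorphic to each other; in particular the trivial group belongs to every $\mathcal A_{p,m}$. Then, for every integer $k\ge 0$, the three series below converge and $$\sum_{G\in\mathcal A_{p,k+1}}\frac1{|G|}\;=\;\sum_{G\in\mathcal A_p}\frac1{|G|^k\,|\mathrm{Aut}(G)|}\;=\;\Bigl(1-\frac1p\Bigr)\Bigl(1-\frac1{p^2}\Bigr)\cdots\Bigl(1-\frac1{p^k}\Bigr)\sum_{G\in\mathcal A_p}\frac1{|G|}.$$ -/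

import Mathlib

/-- A finite abelian `p`-group, bundled (every finite group is isomorphic to one in `Type`). -/
structure FinAbPGroup (p : ℕ) : Type 1 where
  carrier : Type
  [commGroup : CommGroup carrier]
  [finite : Finite carrier]
  isPGroup : IsPGroup p carrier

namespace FinAbPGroup

attribute [instance] FinAbPGroup.commGroup FinAbPGroup.finite

/-- Isomorphism of finite abelian `p`-groups, as an equivalence relation. -/
instance isoSetoid (p : ℕ) : Setoid (FinAbPGroup p) where
  r G H := Nonempty (G.carrier ≃* H.carrier)
  iseqv :=
    { refl := fun G => ⟨MulEquiv.refl G.carrier⟩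
      symm := fun ⟨e⟩ => ⟨e.symm⟩
      trans := fun ⟨e⟩ ⟨f⟩ => ⟨e.trans f⟩ }

/-- The cyclic group of order `n` (for `n > 0`), written multiplicatively. -/
abbrev Cyc (n : ℕ) : Type := Multiplicative (ZMod n)

/-- `lam 0 ≥ lam 1 ≥ …` is the list of exponents of a decomposition of `G` as a direct product of
cyclic groups of orders `p ^ lam 0, p ^ lam 1, …`, in decreasing order. The list is finite and
padded with zeros, that is, with trivial factors. -/
def IsDecomposition (p : ℕ) (G : Type) [CommGroup G] (lam : ℕ → ℕ) : Prop :=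
  Antitone lam ∧ ∃ r : ℕ, (∀ i, r ≤ i → lam i = 0) ∧
    Nonempty (G ≃* ((i : Fin r) → Cyc (p ^ lam i)))

/-- In the decomposition of `G` into cyclic factors of decreasing orders, the first `m` factors
are isomorphic to each other. -/
def FirstFactorsIso (p m : ℕ) (G : Type) [CommGroup G] : Prop :=
  ∃ lam : ℕ → ℕ, IsDecomposition p G lam ∧
    ∀ i j, i < m → j < m → Nonempty (Cyc (p ^ lam i) ≃* Cyc (p ^ lam j))

theorem FirstFactorsIso.of_mulEquiv {p m : ℕ} {G H : Type} [CommGroup G] [CommGroup H]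
    (e : G ≃* H) (h : FirstFactorsIso p m G) : FirstFactorsIso p m H := by
  obtain ⟨lam, ⟨hanti, r, hr, ⟨f⟩⟩, hiso⟩ := h
  exact ⟨lam, ⟨hanti, r, hr, ⟨e.symm.trans f⟩⟩, hiso⟩

end FinAbPGroup

/-- The isomorphism classes of finite abelian `p`-groups. -/
def AbPClass (p : ℕ) : Type 1 := Quotient (FinAbPGroup.isoSetoid p)

namespace AbPClass

/-- The order `|G|`. -/
noncomputable def order {p : ℕ} (x : AbPClass p) : ℕ :=
  Quotient.lift (fun G : FinAbPGroup p => Nat.card G.carrier)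
    (by rintro _ _ ⟨e⟩; exact Nat.card_congr e.toEquiv) x

/-- The order `|Aut(G)|` of the automorphism group. -/
noncomputable def autOrder {p : ℕ} (x : AbPClass p) : ℕ :=
  Quotient.lift (fun G : FinAbPGroup p => Nat.card (MulAut G.carrier))
    (by rintro _ _ ⟨e⟩; exact Nat.card_congr (MulAut.congr e).toEquiv) x

/-- The set of isomorphism classes of finite abelian `p`-groups whose first `m` cyclic factors are
isomorphic. -/
def firstIso (p m : ℕ) : Set (AbPClass p) :=
  {x | Quotient.lift (fun G : FinAbPGroup p => FinAbPGroup.FirstFactorsIso p m G.carrier)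
    (by rintro _ _ ⟨e⟩; exact propext ⟨fun h => h.of_mulEquiv e, fun h => h.of_mulEquiv e.symm⟩) x}

end AbPClass

/-! ### Partial Euler products -/

open scoped ENNReal

/-! Put q = 1/p. The first and the second series both equal the tail ∏_{j>k} (1 - q^j)⁻¹ of an Euler
product. For k = 0 the condition on the factors is empty, so the sum over all groups is the full
product, and comparing it with the tail leaves exactly the factors with j ≤ k. The sums are computed
in `ℝ≥0∞`, where rearrangement is free; finiteness then gives summability in ℝ.

First series: groups correspond to partitions, with |G| = p^|λ|, and the condition says that the
first k + 1 parts are equal. Removing the excess of these parts over the next one splits off a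
geometric series (1 - q^(k+1))⁻¹ and leaves a partition whose first k + 2 parts are equal
(`tsum_flatPartition_succ`); this is iterated.

Second series: weight each subgroup of p-power index in ℤ^n by index^(-(n+k)). Projecting to one
coordinate at a time evaluates the sum as ∏_{k<j≤k+n} (1 - q^j)⁻¹ (`subgroupZeta_prod_int`).
Grouping by the quotient G turns it into ∑_G (|Sur(ℤ^n, G)| / |G|^n) · 1/(|G|^k |Aut G|)
(`subgroupZeta_eq_tsum`). The ratio is at most 1 and tends to 1, so n → ∞ gives the claim
(`AbPClass.tsum_inv_autOrder_mul`). -/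

/-- The partial Euler product `∏ (1 - q ^ j)⁻¹` over `k < j ≤ k + N`. -/
noncomputable def eulerProd (q : ℝ≥0∞) (k N : ℕ) : ℝ≥0∞ :=
  ∏ j ∈ Finset.range N, (1 - q ^ (k + 1 + j))⁻¹

theorem eulerProd_zero_right (q : ℝ≥0∞) (k : ℕ) : eulerProd q k 0 = 1 := by
  simp [eulerProd]

theorem eulerProd_succ (q : ℝ≥0∞) (k N : ℕ) :
    eulerProd q k (N + 1) = eulerProd q k N * (1 - q ^ (k + N + 1))⁻¹ := by
  rw [eulerProd, Finset.prod_range_succ, add_right_comm]; rfl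

theorem eulerProd_succ' (q : ℝ≥0∞) (k N : ℕ) :
    eulerProd q k (N + 1) = (1 - q ^ (k + 1))⁻¹ * eulerProd q (k + 1) N := by
  rw [eulerProd, Finset.prod_range_succ', mul_comm, eulerProd]
  simp [add_comm, add_left_comm]

theorem eulerProd_add (q : ℝ≥0∞) (k N : ℕ) :
    eulerProd q 0 (k + N) = eulerProd q 0 k * eulerProd q k N := by
  rw [eulerProd, Finset.prod_range_add, eulerProd, eulerProd]
  simp only [zero_add, add_comm 1, add_assoc]

theorem one_le_inv_one_sub (x : ℝ≥0∞) : 1 ≤ (1 - x)⁻¹ :=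
  ENNReal.one_le_inv.2 tsub_le_self

theorem eulerProd_mono (q : ℝ≥0∞) (k : ℕ) : Monotone (eulerProd q k) :=
  monotone_nat_of_le_succ fun N => by
    rw [eulerProd_succ]
    exact le_mul_of_one_le_right' (one_le_inv_one_sub _)

/-! ### Generating function of partitions with equal first parts -/

/-- The function `ℕ →₀ ℕ` equal to `a` on `0, …, k` and to zero elsewhere. -/
noncomputable def initialBlock (k a : ℕ) : ℕ →₀ ℕ :=
  ∑ i ∈ Finset.range (k + 1), Finsupp.single i a

theorem initialBlock_apply (k a i : ℕ) : initialBlock k a i = if i ≤ k then a else 0 := by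
  simp [initialBlock, Finsupp.finsetSum_apply, Finsupp.single_apply]

theorem degree_initialBlock (k a : ℕ) : (initialBlock k a).degree = (k + 1) * a := by
  simp [initialBlock, map_sum]

/-- Partitions with at most `n` parts, the first `k + 1` of which are equal. -/
abbrev FlatPartition (k n : ℕ) : Type :=
  {f : ℕ →₀ ℕ // Antitone f ∧ (∀ i ≤ k, f i = f 0) ∧ ∀ i, n ≤ i → f i = 0}

/-- Adding the same number to the first `k + 1` parts. -/
noncomputable def addInitialBlock (k n : ℕ) (hkn : k < n) (x : ℕ × FlatPartition (k + 1) n) :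
    FlatPartition k n :=
  ⟨x.2.1 + initialBlock k x.1, by
    obtain ⟨a, f, hf, hf', hf''⟩ := x
    refine ⟨fun i j hij => ?_, fun i hi => ?_, fun i hi => ?_⟩
    · have := hf hij
      simp only [Finsupp.add_apply, initialBlock_apply]
      split_ifs <;> omega
    · have := hf' i (by omega)
      simp [initialBlock_apply, hi, this]
    · have := hf'' i hi
      simp [initialBlock_apply, this]; omega⟩

/-- The inverse subtracts f k - f (k + 1) from the first k + 1 parts, which levels them with part k
+ 1. -/
theorem addInitialBlock_bijective (k n : ℕ) (hkn : k < n) :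
    Function.Bijective (addInitialBlock k n hkn) := by
  constructor
  · rintro ⟨a, f, hf, hf', hf''⟩ ⟨b, g, hg, hg', hg''⟩ h
    have h' : ∀ i, f i + (if i ≤ k then a else 0) = g i + (if i ≤ k then b else 0) := fun i => by
      simpa [addInitialBlock, initialBlock_apply] using
        congrArg (fun z : FlatPartition k n => z.1 i) h
    have h0 := h' 0
    have h1 := h' (k + 1)
    rw [hf' (k + 1) le_rfl, hg' (k + 1) le_rfl] at h1
    simp only [Nat.zero_le, if_true, Nat.not_succ_le_self, if_false] at h0 h1
    have hab : a = b := by omega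
    subst hab
    simp only [Prod.mk.injEq, true_and, Subtype.mk.injEq]
    ext i
    exact Nat.add_right_cancel (h' i)
  · rintro ⟨f, hf, hf', hf''⟩
    have key : ∀ i ≤ k, f i = f k := fun i hi => by rw [hf' i hi, hf' k le_rfl]
    have hk := hf (Nat.le_succ k)
    refine ⟨⟨f k - f (k + 1), f - initialBlock k (f k - f (k + 1)), ?_, ?_, ?_⟩, ?_⟩
    · intro i j hij
      have := hf hij
      simp only [Finsupp.tsub_apply, initialBlock_apply]
      by_cases hi : i ≤ k
      · by_cases hj : j ≤ k
        · simp only [hi, hj, if_true]; omega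
        · have := hf (show k + 1 ≤ j by omega)
          have := key i hi
          simp only [hi, hj, if_true, if_false]
          simp only [Nat.succ_eq_add_one] at hk
          omega
      · have hj : ¬ j ≤ k := by omega
        simp only [hi, hj, if_false]; omega
    · have aux : ∀ i ≤ k + 1, (f - initialBlock k (f k - f (k + 1))) i = f (k + 1) := by
        intro i hi
        simp only [Finsupp.tsub_apply, initialBlock_apply]
        simp only [Nat.succ_eq_add_one] at hk
        by_cases hik : i ≤ k
        · have := key i hik
          simp only [hik, if_true]; omega
        · have : i = k + 1 := by omega
          subst this; simp
      intro i hi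
      rw [aux i hi, aux 0 (Nat.zero_le _)]
    · intro i hi
      simp [hf'' i hi]
    · refine Subtype.ext (Finsupp.ext fun i => ?_)
      simp only [addInitialBlock, Finsupp.add_apply, Finsupp.tsub_apply, initialBlock_apply]
      split_ifs with hi
      · have := key i hi
        omega
      · omega

/-- A block of height a adds (k + 1) a to the degree, so summing over a is a geometric series in
q^(k+1). -/
theorem tsum_flatPartition_succ (q : ℝ≥0∞) {k n : ℕ} (hkn : k < n) :
    ∑' f : FlatPartition k n, q ^ f.1.degree =
      (1 - q ^ (k + 1))⁻¹ * ∑' f : FlatPartition (k + 1) n, q ^ f.1.degree := by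
  rw [← (Equiv.ofBijective _ (addInitialBlock_bijective k n hkn)).tsum_eq, ENNReal.tsum_prod',
    ← ENNReal.tsum_geometric, ← ENNReal.tsum_mul_right]
  refine tsum_congr fun a => ?_
  rw [← ENNReal.tsum_mul_left]
  refine tsum_congr fun f => ?_
  simp only [Equiv.ofBijective_apply, addInitialBlock, map_add, degree_initialBlock]
  rw [pow_add, pow_mul, mul_comm]

/-- Indexing from 0, the n + 1 equal parts include part n, which vanishes; only the zero partition
is left. -/
theorem tsum_flatPartition_self (q : ℝ≥0∞) (n : ℕ) :
    ∑' f : FlatPartition n n, q ^ f.1.degree = 1 := by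
  have hz : ∀ f : FlatPartition n n, f.1 = 0 := fun ⟨f, hf, hf', hf''⟩ => by
    ext i
    rcases le_total i n with h | h
    · simp [hf' i h, ← hf' n le_rfl, hf'' n le_rfl]
    · exact hf'' i h
  rw [tsum_eq_single ⟨0, fun _ _ _ => le_rfl, fun _ _ => rfl, fun _ _ => rfl⟩]
  · simp
  · exact fun f hf => absurd (Subtype.ext (hz f)) hf

theorem tsum_flatPartition (q : ℝ≥0∞) (k N : ℕ) :
    ∑' f : FlatPartition k (k + N), q ^ f.1.degree = eulerProd q k N := by
  induction N generalizing k with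
  | zero => rw [add_zero, tsum_flatPartition_self, eulerProd_zero_right]
  | succ N ih =>
    rw [tsum_flatPartition_succ q (by omega), eulerProd_succ', ← ih (k + 1),
      show k + 1 + N = k + (N + 1) by omega]

/-- Finitely many partitions have a bounded number of parts, so every finite partial sum is below
some `eulerProd q k N`. -/
theorem tsum_partition_eq_iSup (q : ℝ≥0∞) (k : ℕ) :
    ∑' f : {f : ℕ →₀ ℕ // Antitone f ∧ ∀ i ≤ k, f i = f 0}, q ^ f.1.degree =
      ⨆ N, eulerProd q k N := by
  apply le_antisymm
  · rw [ENNReal.tsum_eq_iSup_sum]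
    refine iSup_le fun s => ?_
    obtain ⟨N, hN⟩ : ∃ N, ∀ f ∈ s, ∀ i, N ≤ i → f.1 i = 0 := by
      refine ⟨s.sup (fun f => f.1.support.sup id + 1), fun f hf i hi => ?_⟩
      by_contra h
      have h1 : i ≤ f.1.support.sup id :=
        Finset.le_sup (f := id) (Finsupp.mem_support_iff.2 h)
      have h2 : f.1.support.sup id + 1 ≤ s.sup (fun f => f.1.support.sup id + 1) :=
        Finset.le_sup (f := fun f : {f : ℕ →₀ ℕ // Antitone f ∧ ∀ i ≤ k, f i = f 0} =>
          f.1.support.sup id + 1) hf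
      omega
    refine le_iSup_of_le N ?_
    rw [← tsum_flatPartition, ← Finset.tsum_subtype' s fun f => q ^ f.1.degree]
    let φ : s → FlatPartition k (k + N) := fun f =>
      ⟨f.1.1, f.1.2.1, f.1.2.2, fun i hi => hN _ f.2 i (by omega)⟩
    have hφ : Function.Injective φ := fun f g h =>
      Subtype.ext (Subtype.ext (congrArg (fun z : FlatPartition k (k + N) => z.1) h))
    exact ENNReal.tsum_comp_le_tsum_of_injective hφ fun f => q ^ f.1.degree
  · refine iSup_le fun N => ?_
    rw [← tsum_flatPartition]
    let φ : FlatPartition k (k + N) → {f : ℕ →₀ ℕ // Antitone f ∧ ∀ i ≤ k, f i = f 0} :=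
      fun f => ⟨f.1, f.2.1, f.2.2.1⟩
    have hφ : Function.Injective φ := fun f g h => Subtype.ext (congrArg
      (fun z : {f : ℕ →₀ ℕ // Antitone f ∧ ∀ i ≤ k, f i = f 0} => z.1) h)
    exact ENNReal.tsum_comp_le_tsum_of_injective hφ fun f => q ^ f.1.degree

/-- Source of the factor (1 - 1/p)⋯(1 - 1/p^k) in the theorem. -/
theorem iSup_eulerProd_zero (q : ℝ≥0∞) (k : ℕ) :
    ⨆ N, eulerProd q 0 N = eulerProd q 0 k * ⨆ N, eulerProd q k N := by
  rw [ENNReal.mul_iSup]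
  simp_rw [← eulerProd_add]
  refine le_antisymm (iSup_mono fun N => eulerProd_mono q 0 (by omega))
    (iSup_le fun N => le_iSup (eulerProd q 0) (k + N))

theorem iSup_eulerProd_ne_top {q : ℝ≥0∞} (hq : q ≤ 2⁻¹) (k : ℕ) :
    ⨆ N, eulerProd q k N ≠ ∞ := by
  -- For 0 ≤ x ≤ 1/2 one has (1 - x)(1 + 2x) ≥ 1, hence (1 - x)⁻¹ ≤ exp (2x). The exponents then sum
  -- to at most 2, uniformly in N.
  have h1 : ∀ j, (1 - q ^ (k + 1 + j))⁻¹ ≤ ENNReal.ofReal (Real.exp (2 * (1 / 2) ^ (j + 1))) := by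
    intro j
    have hx : q ^ (k + 1 + j) ≤ ENNReal.ofReal ((1 / 2) ^ (j + 1)) := by
      rw [ENNReal.ofReal_pow (by norm_num), show ENNReal.ofReal (1 / 2) = 2⁻¹ by
        rw [one_div, ENNReal.ofReal_inv_of_pos (by norm_num)]; simp]
      calc q ^ (k + 1 + j) ≤ 2⁻¹ ^ (k + 1 + j) := by gcongr
        _ ≤ 2⁻¹ ^ (j + 1) :=
          pow_le_pow_right_of_le_one' (ENNReal.inv_le_one.2 (by norm_num)) (by omega)
    have h2 : ((1 : ℝ) / 2) ^ (j + 1) ≤ 1 / 2 := by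
      calc ((1 : ℝ) / 2) ^ (j + 1) ≤ (1 / 2) ^ 1 :=
            pow_le_pow_of_le_one (by norm_num) (by norm_num) (by omega)
        _ = 1 / 2 := pow_one _
    have h3 : (0 : ℝ) < (1 / 2) ^ (j + 1) := by positivity
    set x : ℝ := (1 / 2) ^ (j + 1)
    calc (1 - q ^ (k + 1 + j))⁻¹ ≤ (1 - ENNReal.ofReal x)⁻¹ := by gcongr
      _ = ENNReal.ofReal ((1 - x)⁻¹) := by
        rw [ENNReal.ofReal_inv_of_pos (by linarith), ENNReal.ofReal_sub _ h3.le,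
          ENNReal.ofReal_one]
      _ ≤ _ := by
        apply ENNReal.ofReal_le_ofReal
        have h4 := Real.add_one_le_exp (2 * x)
        refine le_trans ?_ h4
        rw [inv_le_iff_one_le_mul₀ (by linarith)]
        nlinarith
  refine ne_top_of_le_ne_top (b := ENNReal.ofReal (Real.exp 2)) ENNReal.ofReal_ne_top
    (iSup_le fun N => ?_)
  calc eulerProd q k N ≤ ∏ j ∈ Finset.range N, ENNReal.ofReal (Real.exp (2 * (1 / 2) ^ (j + 1))) :=
        Finset.prod_le_prod' fun j _ => h1 j
    _ = ENNReal.ofReal (Real.exp (∑ j ∈ Finset.range N, 2 * (1 / 2) ^ (j + 1))) := by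
        rw [Real.exp_sum, ENNReal.ofReal_prod_of_nonneg fun _ _ => (Real.exp_pos _).le]
    _ ≤ _ := by
        apply ENNReal.ofReal_le_ofReal
        apply Real.exp_le_exp.2
        calc ∑ j ∈ Finset.range N, 2 * ((1 : ℝ) / 2) ^ (j + 1)
            = ∑ j ∈ Finset.range N, ((1 : ℝ) / 2) ^ j :=
              Finset.sum_congr rfl fun j _ => by rw [pow_succ]; ring
          _ ≤ 2 := sum_geometric_two_le N

/-! ### Finite abelian p-groups and partitions -/

open FinAbPGroup in
theorem card_torsion_cyc {p : ℕ} (hp : p.Prime) (a j : ℕ) :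
    Nat.card {x : Cyc (p ^ a) // x ^ p ^ j = 1} = p ^ min a j := by
  have : NeZero (p ^ a) := ⟨pow_ne_zero _ hp.ne_zero⟩
  have h := IsCyclic.card_powMonoidHom_ker (G := Cyc (p ^ a)) (p ^ j)
  have hc : Nat.card (Cyc (p ^ a)) = p ^ a := by
    rw [Nat.card_congr Multiplicative.toAdd, Nat.card_zmod]
  rw [hc] at h
  have hg : (p ^ a).gcd (p ^ j) = p ^ min a j := by
    rcases le_total a j with hj | hj
    · rw [min_eq_left hj, Nat.gcd_eq_left (pow_dvd_pow p hj)]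
    · rw [min_eq_right hj, Nat.gcd_eq_right (pow_dvd_pow p hj)]
  rw [← hg, ← h]
  rfl

open FinAbPGroup in
theorem card_torsion {p : ℕ} (hp : p.Prime) {G : Type} [CommGroup G] {f : ℕ → ℕ} {r : ℕ}
    (e : G ≃* ((i : Fin r) → Cyc (p ^ f i))) (j : ℕ) :
    Nat.card {x : G // x ^ p ^ j = 1} = p ^ ∑ i ∈ Finset.range r, min (f i) j := by
  have h1 : {x : G // x ^ p ^ j = 1} ≃ {y : (i : Fin r) → Cyc (p ^ f i) // ∀ i, y i ^ p ^ j = 1} :=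
    e.toEquiv.subtypeEquiv fun x => by
      rw [← map_eq_one_iff e e.injective, map_pow, funext_iff]; rfl
  rw [Nat.card_congr (h1.trans
    (Equiv.subtypePiEquivPi (p := fun (i : Fin r) (x : Cyc (p ^ f i)) => x ^ p ^ j = 1))), Nat.card_pi,
    Finset.prod_congr rfl fun (i : Fin r) _ => card_torsion_cyc hp (f i) j, Finset.prod_pow_eq_pow_sum,
    Finset.sum_range fun i => min (f i) j]

/-- An antitone sequence that vanishes from `R` on is determined by the numbers
`∑ i < R, min (f i) j`. -/
theorem Antitone.eq_of_sum_min_eq {f g : ℕ → ℕ} (hf : Antitone f) (hg : Antitone g) {R : ℕ}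
    (hfR : ∀ i, R ≤ i → f i = 0) (hgR : ∀ i, R ≤ i → g i = 0)
    (h : ∀ j, ∑ i ∈ Finset.range R, min (f i) j = ∑ i ∈ Finset.range R, min (g i) j) : f = g := by
  -- Raising the cutoff from j to j + 1 gains one for each entry above j, so the sums determine the
  -- sizes of the superlevel sets.
  have step : ∀ (u : ℕ → ℕ) (j : ℕ), ∑ i ∈ Finset.range R, min (u i) (j + 1) =
      ∑ i ∈ Finset.range R, min (u i) j + ((Finset.range R).filter fun i => j < u i).card := by
    intro u j
    rw [Finset.card_filter, ← Finset.sum_add_distrib]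
    refine Finset.sum_congr rfl fun i _ => ?_
    split_ifs <;> omega
  have hcard : ∀ j, ((Finset.range R).filter fun i => j < f i).card =
      ((Finset.range R).filter fun i => j < g i).card := fun j => by
    have h1 := step f j
    have h2 := step g j
    have h3 := h j
    have h4 := h (j + 1)
    omega
  -- Superlevel sets of antitone sequences are initial segments, hence nested; equal size then
  -- forces equality.
  have hcmp : ∀ {u v : ℕ → ℕ}, Antitone u → Antitone v → ∀ j,
      ((Finset.range R).filter fun i => j < u i) ⊆ ((Finset.range R).filter fun i => j < v i) ∨
      ((Finset.range R).filter fun i => j < v i) ⊆ ((Finset.range R).filter fun i => j < u i) := by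
    intro u v hu hv j
    by_contra! hc
    obtain ⟨h1, h2⟩ := hc
    obtain ⟨a, ha, ha'⟩ := Finset.not_subset.1 h1
    obtain ⟨b, hb, hb'⟩ := Finset.not_subset.1 h2
    simp only [Finset.mem_filter, Finset.mem_range, not_and, not_lt] at ha ha' hb hb'
    have := ha' ha.1
    have := hb' hb.1
    rcases le_total a b with hab | hab
    · have := hv hab; omega
    · have := hu hab; omega
  have heq : ∀ j, ((Finset.range R).filter fun i => j < f i) =
      ((Finset.range R).filter fun i => j < g i) := fun j => by
    rcases hcmp hf hg j with h | h
    · exact Finset.eq_of_subset_of_card_le h (hcard j).ge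
    · exact (Finset.eq_of_subset_of_card_le h (hcard j).le).symm
  funext i
  rcases le_or_gt R i with hi | hi
  · rw [hfR i hi, hgR i hi]
  · refine eq_of_forall_lt_iff fun j => ?_
    simpa [hi] using Finset.ext_iff.1 (heq j) i

namespace FinAbPGroup

/-- Uniqueness of the type: the orders of the p^j-torsion subgroups recover it. The two lists may
have different lengths, so both are padded with zeros to the longer one. -/
theorem IsDecomposition.eq {p : ℕ} (hp : p.Prime) {G : Type} [CommGroup G] {f g : ℕ → ℕ}
    (hf : IsDecomposition p G f) (hg : IsDecomposition p G g) : f = g := by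
  obtain ⟨hf, r, hr, ⟨e⟩⟩ := hf
  obtain ⟨hg, s, hs, ⟨e'⟩⟩ := hg
  refine hf.eq_of_sum_min_eq hg (R := max r s) (fun i hi => hr i (le_of_max_le_left hi))
    (fun i hi => hs i (le_of_max_le_right hi)) fun j => ?_
  have h := (card_torsion hp e j).symm.trans (card_torsion hp e' j)
  have hext : ∀ (u : ℕ → ℕ) (t : ℕ), t ≤ max r s → (∀ i, t ≤ i → u i = 0) →
      ∑ i ∈ Finset.range (max r s), min (u i) j = ∑ i ∈ Finset.range t, min (u i) j := by
    intro u t ht hu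
    symm
    refine Finset.sum_subset (Finset.range_mono ht) fun i _ hi => ?_
    rw [hu i (by simpa using hi), Nat.zero_min]
  rw [hext f r (le_max_left _ _) hr, hext g s (le_max_right _ _) hs]
  exact Nat.pow_right_injective hp.two_le h

theorem card_cyc (n : ℕ) : Nat.card (Cyc n) = n := by
  rw [Nat.card_congr Multiplicative.toAdd, Nat.card_zmod]

theorem IsDecomposition.card {p : ℕ} {G : Type} [CommGroup G] {f : ℕ →₀ ℕ}
    (h : IsDecomposition p G f) : Nat.card G = p ^ f.degree := by
  obtain ⟨-, r, hr, ⟨e⟩⟩ := h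
  rw [Nat.card_congr e.toEquiv, Nat.card_pi]
  simp_rw [card_cyc]
  rw [Finset.prod_pow_eq_pow_sum, ← Finset.sum_range fun i => f i, Finsupp.degree_apply]
  congr 1
  symm
  refine Finset.sum_subset (fun i hi => ?_) fun i _ hi => by simpa using hi
  by_contra hc
  exact Finsupp.mem_support_iff.1 hi (hr i (by simpa using hc))

theorem IsDecomposition.firstFactorsIso_iff {p : ℕ} (hp : p.Prime) {G : Type} [CommGroup G]
    {f : ℕ → ℕ} (h : IsDecomposition p G f) (k : ℕ) :
    FirstFactorsIso p (k + 1) G ↔ ∀ i ≤ k, f i = f 0 := by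
  constructor
  · rintro ⟨g, hg, hiso⟩ i hi
    rw [h.eq hp hg]
    obtain ⟨e⟩ := hiso i 0 (by omega) (by omega)
    have := Nat.card_congr e.toEquiv
    rw [card_cyc, card_cyc] at this
    exact Nat.pow_right_injective hp.two_le this
  · refine fun hk => ⟨f, h, fun i j hi hj => ?_⟩
    rw [hk i (by omega), hk j (by omega)]
    exact ⟨MulEquiv.refl _⟩

theorem exists_isDecomposition {p : ℕ} (hp : p.Prime) (G : Type) [CommGroup G] [Finite G]
    (hG : IsPGroup p G) : ∃ f : ℕ →₀ ℕ, IsDecomposition p G f := by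
  have : Fact p.Prime := ⟨hp⟩
  obtain ⟨ι, _, n, -, ⟨e⟩⟩ := CommGroup.equiv_prod_multiplicative_zmod_of_finite G
  obtain ⟨N, hN⟩ := hG.exists_card_eq
  have hn : ∀ i, ∃ a, n i = p ^ a := fun i => by
    have hd : n i ∣ p ^ N := by
      rw [← hN, Nat.card_congr e.toEquiv, Nat.card_pi]
      simp_rw [card_cyc]
      exact Finset.dvd_prod_of_mem _ (Finset.mem_univ i)
    obtain ⟨a, -, ha⟩ := (Nat.dvd_prime_pow hp).1 hd
    exact ⟨a, ha⟩
  choose a ha using hn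
  obtain rfl : n = fun i => p ^ a i := funext ha
  set r := Fintype.card ι
  let σ₀ : Fin r ≃ ι := (Fintype.equivFin ι).symm
  -- `Tuple.sort` sorts increasingly; the order dual makes the exponents decrease.
  let b : Fin r → ℕᵒᵈ := fun i => OrderDual.toDual (a (σ₀ i))
  let σ : Fin r ≃ ι := (Tuple.sort b).trans σ₀
  have hσ : Antitone fun i => a (σ i) := fun i j hij => Tuple.monotone_sort b hij
  let F : ℕ → ℕ := fun i => if h : i < r then a (σ ⟨i, h⟩) else 0
  have hF0 : ∀ i, r ≤ i → F i = 0 := fun i hi => dif_neg (by omega)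
  have hF1 : ∀ i : Fin r, F i = a (σ i) := fun i => dif_pos i.2
  refine ⟨Finsupp.onFinset (Finset.range r) F fun i hi => ?_, ?_, r, hF0, ⟨?_⟩⟩
  · by_contra hc
    exact hi (hF0 i (by simpa using hc))
  · intro i j hij
    change F j ≤ F i
    by_cases hj : j < r
    · have hi : i < r := by omega
      simp only [F, hi, hj, dif_pos]
      exact hσ (show (⟨i, hi⟩ : Fin r) ≤ ⟨j, hj⟩ from hij)
    · rw [hF0 j (by omega)]; exact Nat.zero_le _
  · refine e.trans ?_
    let e1 : ((i : ι) → Cyc (p ^ a i)) ≃* ((i : Fin r) → Cyc (p ^ a (σ i))) :=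
      ⟨Equiv.piCongrLeft' (fun i => Cyc (p ^ a i)) σ.symm, fun _ _ => rfl⟩
    refine e1.trans (MulEquiv.piCongrRight fun i => ?_)
    change Cyc (p ^ a (σ i)) ≃* Cyc (p ^ F i)
    rw [hF1 i]

/-- The product of cyclic groups of orders `p ^ f i`. -/
def ofPartition {p : ℕ} (hp : p.Prime) (f : ℕ →₀ ℕ) : FinAbPGroup p :=
  haveI : ∀ i, NeZero (p ^ f i) := fun i => ⟨pow_ne_zero _ hp.ne_zero⟩
  { carrier := (i : Fin (f.support.sup id + 1)) → Cyc (p ^ f i)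
    finite := inferInstance
    isPGroup := IsPGroup.of_card (n := ∑ i : Fin (f.support.sup id + 1), f i) <| by
      rw [Nat.card_pi]
      simp_rw [card_cyc]
      rw [Finset.prod_pow_eq_pow_sum] }

theorem isDecomposition_ofPartition {p : ℕ} (hp : p.Prime) {f : ℕ →₀ ℕ} (hf : Antitone f) :
    IsDecomposition p (ofPartition hp f).carrier f := by
  refine ⟨hf, _, fun i hi => ?_, ⟨MulEquiv.refl _⟩⟩
  by_contra hc
  have : i ≤ f.support.sup id := Finset.le_sup (f := id) (Finsupp.mem_support_iff.2 hc)
  omega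

theorem IsDecomposition.of_mulEquiv {p : ℕ} {G H : Type} [CommGroup G] [CommGroup H] (e : G ≃* H)
    {f : ℕ → ℕ} (h : IsDecomposition p G f) : IsDecomposition p H f := by
  obtain ⟨hf, r, hr, ⟨e'⟩⟩ := h
  exact ⟨hf, r, hr, ⟨e.symm.trans e'⟩⟩

theorem nonempty_mulEquiv_pi_cyc {p : ℕ} {f : ℕ → ℕ} {r s : ℕ} (hrs : r ≤ s)
    (hr : ∀ i, r ≤ i → f i = 0) :
    Nonempty (((i : Fin s) → Cyc (p ^ f i)) ≃* ((i : Fin r) → Cyc (p ^ f i))) := by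
  let φ : ((i : Fin s) → Cyc (p ^ f i)) →* ((i : Fin r) → Cyc (p ^ f i)) :=
    { toFun := fun y i => y (Fin.castLE hrs i)
      map_one' := rfl
      map_mul' := fun _ _ => rfl }
  refine ⟨MulEquiv.ofBijective φ ⟨fun y z h => funext fun i => ?_, fun z => ?_⟩⟩
  · by_cases hi : (i : ℕ) < r
    · exact congrFun h ⟨i, hi⟩
    · have hs : Subsingleton (Cyc (p ^ f i)) := by
        rw [hr i (by omega), pow_zero]
        exact inferInstanceAs (Subsingleton (ZMod 1))
      exact hs.elim _ _
  · exact ⟨fun i => if h : (i : ℕ) < r then z ⟨i, h⟩ else 1,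
      funext fun i => dif_pos (show ((Fin.castLE hrs i : Fin s) : ℕ) < r from i.2)⟩

theorem IsDecomposition.nonempty_mulEquiv {p : ℕ} {G H : Type} [CommGroup G] [CommGroup H]
    {f : ℕ → ℕ} (hG : IsDecomposition p G f) (hH : IsDecomposition p H f) :
    Nonempty (G ≃* H) := by
  obtain ⟨-, r, hr, ⟨e⟩⟩ := hG
  obtain ⟨-, s, hs, ⟨e'⟩⟩ := hH
  rcases le_total r s with h | h
  · obtain ⟨φ⟩ := nonempty_mulEquiv_pi_cyc (p := p) h hr
    exact ⟨e.trans (φ.symm.trans e'.symm)⟩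
  · obtain ⟨φ⟩ := nonempty_mulEquiv_pi_cyc (p := p) h hs
    exact ⟨e.trans (φ.trans e'.symm)⟩

end FinAbPGroup

/-! ### The first and third series as Euler products -/

namespace AbPClass

open FinAbPGroup

/-- The isomorphism class with a given type, whose first `k + 1` cyclic factors are isomorphic. -/
def ofPartition {p : ℕ} (hp : p.Prime) (k : ℕ)
    (f : {f : ℕ →₀ ℕ // Antitone f ∧ ∀ i ≤ k, f i = f 0}) : firstIso p (k + 1) :=
  ⟨Quotient.mk _ (FinAbPGroup.ofPartition hp f.1),
    ((isDecomposition_ofPartition hp f.2.1).firstFactorsIso_iff hp k).2 f.2.2⟩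

theorem ofPartition_bijective {p : ℕ} (hp : p.Prime) (k : ℕ) :
    Function.Bijective (ofPartition hp k) := by
  constructor
  · intro f g h
    obtain ⟨e⟩ : Nonempty ((FinAbPGroup.ofPartition hp f.1).carrier ≃*
        (FinAbPGroup.ofPartition hp g.1).carrier) :=
      Quotient.exact (congrArg Subtype.val h)
    exact Subtype.ext (DFunLike.coe_injective
      (((isDecomposition_ofPartition hp f.2.1).of_mulEquiv e).eq hp
        (isDecomposition_ofPartition hp g.2.1)))
  · rintro ⟨x, hx⟩
    induction x using Quotient.inductionOn with
    | h G =>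
      obtain ⟨f, hf⟩ := exists_isDecomposition hp G.carrier G.isPGroup
      exact ⟨⟨f, hf.1, (hf.firstFactorsIso_iff hp k).1 hx⟩,
        Subtype.ext (Quotient.sound ((isDecomposition_ofPartition hp hf.1).nonempty_mulEquiv hf))⟩

theorem order_ofPartition {p : ℕ} (hp : p.Prime) (k : ℕ)
    (f : {f : ℕ →₀ ℕ // Antitone f ∧ ∀ i ≤ k, f i = f 0}) :
    (ofPartition hp k f).1.order = p ^ f.1.degree :=
  (isDecomposition_ofPartition hp f.2.1).card

theorem tsum_firstIso {p : ℕ} (hp : p.Prime) (k : ℕ) :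
    ∑' x : firstIso p (k + 1), (x.1.order : ℝ≥0∞)⁻¹ = ⨆ N, eulerProd (p : ℝ≥0∞)⁻¹ k N := by
  rw [← tsum_partition_eq_iSup, ← (Equiv.ofBijective _ (ofPartition_bijective hp k)).tsum_eq]
  refine tsum_congr fun f => ?_
  rw [Equiv.ofBijective_apply, order_ofPartition, Nat.cast_pow, ENNReal.inv_pow]

theorem firstIso_one {p : ℕ} (hp : p.Prime) : firstIso p 1 = Set.univ := by
  refine Set.eq_univ_of_forall fun x => ?_
  induction x using Quotient.inductionOn with
  | h G =>
    obtain ⟨f, hf⟩ := exists_isDecomposition hp G.carrier G.isPGroup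
    exact (hf.firstFactorsIso_iff hp 0).2 fun i hi => by rw [Nat.le_zero.1 hi]

theorem tsum_order_inv {p : ℕ} (hp : p.Prime) :
    ∑' x : AbPClass p, (x.order : ℝ≥0∞)⁻¹ = ⨆ N, eulerProd (p : ℝ≥0∞)⁻¹ 0 N := by
  rw [← tsum_firstIso hp, zero_add, firstIso_one hp,
    tsum_univ fun x : AbPClass p => (x.order : ℝ≥0∞)⁻¹]

end AbPClass

/-! ### Subgroups of p-power index in free abelian groups -/

/-- The subgroups of `A` whose index is a power of `p`. -/
abbrev PPowIndex (p : ℕ) (A : Type) [CommGroup A] : Type :=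
  {H : Subgroup A // ∃ e : ℕ, H.index = p ^ e}

/-- Pass through the chain H ≤ HA ≤ A × B: the lower index is that of H ∩ A in A, the upper one that
of the projection of H in B. -/
theorem index_eq_index_comap_inl_mul_index_map_snd {A B : Type} [CommGroup A] [CommGroup B]
    (H : Subgroup (A × B)) :
    H.index = (H.comap (MonoidHom.inl A B)).index * (H.map (MonoidHom.snd A B)).index := by
  have hk : (MonoidHom.snd A B).ker = (MonoidHom.inl A B).range := by
    ext ⟨a, b⟩
    rw [MonoidHom.mem_ker, MonoidHom.mem_range]
    simp [Prod.ext_iff, eq_comm]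
  have hr : (MonoidHom.snd A B).range = ⊤ := MonoidHom.range_eq_top.2 Prod.snd_surjective
  rw [Subgroup.index_map, Subgroup.index_comap, hr, Subgroup.index_top, mul_one, hk,
    ← Subgroup.relIndex_sup_left _ H, Subgroup.relIndex_mul_index le_sup_left]

theorem index_zpowers_ofAdd (d : ℕ) :
    (Subgroup.zpowers (Multiplicative.ofAdd (d : ℤ))).index = d := by
  have := Int.index_zmultiples (d : ℤ)
  rwa [Int.natAbs_natCast] at this

/-- The subgroup of `A × ℤ` with intersection `K` with `A` and projection `d ℤ` that contains
`(a, d)`. -/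
def extendSubgroup {A : Type} [CommGroup A] (K : Subgroup A) (d : ℕ) (a : A ⧸ K) :
    Subgroup (A × Multiplicative ℤ) where
  carrier := {x | ∃ t : ℤ, x.2 = Multiplicative.ofAdd (d * t : ℤ) ∧ (x.1 : A ⧸ K) = a ^ t}
  one_mem' := ⟨0, by simp⟩
  mul_mem' := by
    rintro ⟨x, z⟩ ⟨y, w⟩ ⟨t, ht, ht'⟩ ⟨s, hs, hs'⟩
    refine ⟨t + s, ?_, ?_⟩
    · simp only [] at ht hs
      simp [ht, hs, mul_add]
    · simp only [] at ht' hs'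
      simp [ht', hs', zpow_add]
  inv_mem' := by
    rintro ⟨x, z⟩ ⟨t, ht, ht'⟩
    refine ⟨-t, ?_, ?_⟩
    · simp only [] at ht
      simp [ht]
    · simp only [] at ht'
      simp [ht']

theorem mem_extendSubgroup {A : Type} [CommGroup A] {K : Subgroup A} {d : ℕ} {a : A ⧸ K}
    {x : A} {z : Multiplicative ℤ} :
    (x, z) ∈ extendSubgroup K d a ↔
      ∃ t : ℤ, z = Multiplicative.ofAdd (d * t : ℤ) ∧ (x : A ⧸ K) = a ^ t := Iff.rfl

theorem comap_inl_extendSubgroup {A : Type} [CommGroup A] (K : Subgroup A) {d : ℕ} (hd : d ≠ 0)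
    (a : A ⧸ K) : (extendSubgroup K d a).comap (MonoidHom.inl A (Multiplicative ℤ)) = K := by
  ext x
  rw [Subgroup.mem_comap, MonoidHom.inl_apply, mem_extendSubgroup, ← QuotientGroup.eq_one_iff]
  constructor
  · rintro ⟨t, ht, ht'⟩
    have h0 : (0 : ℤ) = d * t := Multiplicative.ofAdd.injective (by rw [ofAdd_zero]; exact ht)
    have : t = 0 := by
      rcases mul_eq_zero.1 h0.symm with h | h
      · exact absurd (by exact_mod_cast h) hd
      · exact h
    rw [ht', this, zpow_zero]
  · exact fun h => ⟨0, by simp, by simpa using h⟩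

theorem map_snd_extendSubgroup {A : Type} [CommGroup A] (K : Subgroup A) (d : ℕ) (a : A ⧸ K) :
    (extendSubgroup K d a).map (MonoidHom.snd A (Multiplicative ℤ)) =
      Subgroup.zpowers (Multiplicative.ofAdd (d : ℤ)) := by
  ext z
  rw [Subgroup.mem_map, Subgroup.mem_zpowers_iff]
  constructor
  · rintro ⟨⟨x, w⟩, ⟨t, ht, -⟩, rfl⟩
    refine ⟨t, ?_⟩
    simp only [] at ht
    change _ = w
    rw [ht, mul_comm, ← smul_eq_mul, ofAdd_zsmul]
  · rintro ⟨t, rfl⟩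
    obtain ⟨x, hx⟩ := QuotientGroup.mk_surjective (a ^ t)
    exact ⟨(x, _), ⟨t, by simp [mul_comm], hx⟩, rfl⟩

theorem index_extendSubgroup {A : Type} [CommGroup A] (K : Subgroup A) {d : ℕ} (hd : d ≠ 0)
    (a : A ⧸ K) : (extendSubgroup K d a).index = K.index * d := by
  rw [index_eq_index_comap_inl_mul_index_map_snd, comap_inl_extendSubgroup K hd,
    map_snd_extendSubgroup, index_zpowers_ofAdd]

theorem mk_mem_extendSubgroup_iff {A : Type} [CommGroup A] (K : Subgroup A) {d : ℕ} (hd : d ≠ 0)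
    (a : A ⧸ K) (x : A) :
    (x, Multiplicative.ofAdd (d : ℤ)) ∈ extendSubgroup K d a ↔ (x : A ⧸ K) = a := by
  rw [mem_extendSubgroup]
  constructor
  · rintro ⟨t, ht, ht'⟩
    have h0 : (d : ℤ) * 1 = d * t := by rw [mul_one]; exact Multiplicative.ofAdd.injective ht
    have : (1 : ℤ) = t := mul_left_cancel₀ (by exact_mod_cast hd) h0
    rw [ht', ← this, zpow_one]
  · exact fun h => ⟨1, by simp, by simpa using h⟩

/-- Subgroups of `p`-power index of `A × ℤ` from those of `A`. -/
def extendPPowIndex {p : ℕ} (hp : p.Prime) (A : Type) [CommGroup A]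
    (x : Σ K : PPowIndex p A, ℕ × (A ⧸ K.1)) : PPowIndex p (A × Multiplicative ℤ) :=
  ⟨extendSubgroup x.1.1 (p ^ x.2.1) x.2.2, by
    obtain ⟨⟨K, e, he⟩, i, a⟩ := x
    exact ⟨e + i, by rw [index_extendSubgroup _ (pow_ne_zero _ hp.ne_zero), pow_add, ← he]⟩⟩

theorem extendPPowIndex_bijective {p : ℕ} (hp : p.Prime) (A : Type) [CommGroup A] :
    Function.Bijective (extendPPowIndex hp A) := by
  have hne : ∀ i, p ^ i ≠ 0 := fun i => pow_ne_zero _ hp.ne_zero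
  constructor
  · rintro ⟨⟨K, e, he⟩, i, a⟩ ⟨⟨L, f, hf⟩, j, b⟩ h
    have h' : extendSubgroup K (p ^ i) a = extendSubgroup L (p ^ j) b := congrArg Subtype.val h
    have hKL : K = L := by
      rw [← comap_inl_extendSubgroup K (hne i) a, h', comap_inl_extendSubgroup L (hne j) b]
    subst hKL
    have hij : p ^ i = p ^ j := by
      rw [← index_zpowers_ofAdd (p ^ i), ← map_snd_extendSubgroup K (p ^ i) a, h',
        map_snd_extendSubgroup, index_zpowers_ofAdd]
    have hij := Nat.pow_right_injective hp.two_le hij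
    subst hij
    obtain ⟨x, rfl⟩ := QuotientGroup.mk_surjective a
    have hx := (mk_mem_extendSubgroup_iff K (hne i) (x : A ⧸ K) x).2 rfl
    rw [h'] at hx
    rw [(mk_mem_extendSubgroup_iff K (hne i) b x).1 hx]
  · rintro ⟨H, e, he⟩
    have hidx := index_eq_index_comap_inl_mul_index_map_snd H
    obtain ⟨d, hd⟩ : ∃ d : ℕ, H.map (MonoidHom.snd A (Multiplicative ℤ)) =
        Subgroup.zpowers (Multiplicative.ofAdd (d : ℤ)) := by
      obtain ⟨g, hg⟩ := (Subgroup.isCyclic_iff_exists_zpowers_eq_top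
        (H.map (MonoidHom.snd A (Multiplicative ℤ)))).1 inferInstance
      refine ⟨g.toAdd.natAbs, ?_⟩
      rw [← hg]
      rcases Int.natAbs_eq g.toAdd with h | h
      · rw [← h, ofAdd_toAdd]
      · rw [← Subgroup.zpowers_inv (g := Multiplicative.ofAdd _), ← ofAdd_neg, ← h, ofAdd_toAdd]
    rw [hd, index_zpowers_ofAdd, he] at hidx
    -- The two indices multiply to p^e, so each is a power of p.
    obtain ⟨i, -, rfl⟩ := (Nat.dvd_prime_pow hp).1 (Dvd.intro_left _ hidx.symm)
    obtain ⟨j, -, hj⟩ := (Nat.dvd_prime_pow hp).1 (Dvd.intro _ hidx.symm)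
    obtain ⟨⟨a, z⟩, ha, rfl⟩ : Multiplicative.ofAdd ((p ^ i : ℕ) : ℤ) ∈
        H.map (MonoidHom.snd A (Multiplicative ℤ)) := by
      rw [hd]; exact Subgroup.mem_zpowers _
    refine ⟨⟨⟨H.comap (MonoidHom.inl A (Multiplicative ℤ)), j, hj⟩, i, a⟩, Subtype.ext ?_⟩
    ext ⟨x, z⟩
    -- Dividing by the t-th power of (a, p^i) ∈ H moves the element into A × 1, where membership is
    -- tested by the intersection of H with A.
    have key : ∀ t : ℤ, (x, Multiplicative.ofAdd ((p ^ i : ℕ) * t : ℤ)) ∈ H ↔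
        (x : A ⧸ H.comap (MonoidHom.inl A (Multiplicative ℤ))) = (a : A ⧸ _) ^ t := fun t => by
      have h1 : (x, Multiplicative.ofAdd ((p ^ i : ℕ) * t : ℤ)) =
          ((a ^ t)⁻¹ * x, 1) * (a, Multiplicative.ofAdd ((p ^ i : ℕ) : ℤ)) ^ t := by
        rw [Prod.pow_mk, Prod.mk_mul_mk, one_mul, ← ofAdd_zsmul, smul_eq_mul, mul_comm t,
          mul_right_comm, inv_mul_cancel, one_mul]
      rw [h1, H.mul_mem_cancel_right (H.zpow_mem ha t), ← QuotientGroup.mk_zpow, eq_comm,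
        QuotientGroup.eq]
      rfl
    change (x, z) ∈ extendSubgroup _ _ _ ↔ _
    rw [mem_extendSubgroup]
    constructor
    · rintro ⟨t, rfl, ht⟩
      exact (key t).2 ht
    · intro h
      obtain ⟨t, ht⟩ : z ∈ Subgroup.zpowers (Multiplicative.ofAdd ((p ^ i : ℕ) : ℤ)) := by
        rw [← hd]; exact ⟨(x, z), h, rfl⟩
      have hz : z = Multiplicative.ofAdd ((p ^ i : ℕ) * t : ℤ) := by
        rw [← ht, mul_comm, ← smul_eq_mul, ofAdd_zsmul]
      exact ⟨t, hz, (key t).1 (hz ▸ h)⟩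

/-- The sum of `index⁻ˢ` over the subgroups of `p`-power index. -/
noncomputable def subgroupZeta (p : ℕ) (A : Type) [CommGroup A] (s : ℕ) : ℝ≥0∞ :=
  ∑' H : PPowIndex p A, ((H.1.index : ℝ≥0∞)⁻¹) ^ s

/-- Each K extends in |A/K| ways for every p^i. This count lowers the exponent of K's index from s +
1 to s, and the sum over i is geometric. -/
theorem subgroupZeta_prod_int {p : ℕ} (hp : p.Prime) (A : Type) [CommGroup A] (s : ℕ) :
    subgroupZeta p (A × Multiplicative ℤ) (s + 1) =
      subgroupZeta p A s * (1 - (p : ℝ≥0∞)⁻¹ ^ (s + 1))⁻¹ := by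
  rw [subgroupZeta, ← (Equiv.ofBijective _ (extendPPowIndex_bijective hp A)).tsum_eq,
    ENNReal.tsum_sigma', subgroupZeta, ← ENNReal.tsum_mul_right]
  refine tsum_congr fun K => ?_
  obtain ⟨K, e, he⟩ := K
  have h0 : K.index ≠ 0 := by rw [he]; exact pow_ne_zero _ hp.ne_zero
  have : Finite (A ⧸ K) := Nat.finite_of_card_ne_zero h0
  rw [ENNReal.tsum_prod', ← ENNReal.tsum_geometric, ← ENNReal.tsum_mul_left]
  refine tsum_congr fun i => ?_
  have hterm : ∀ a : A ⧸ K, (((Equiv.ofBijective _ (extendPPowIndex_bijective hp A)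
      ⟨⟨K, e, he⟩, i, a⟩).1.index : ℝ≥0∞)⁻¹) ^ (s + 1) =
      ((K.index : ℝ≥0∞)⁻¹) ^ (s + 1) * ((p : ℝ≥0∞)⁻¹ ^ (s + 1)) ^ i := fun a => by
    simp only [Equiv.ofBijective_apply, extendPPowIndex]
    rw [index_extendSubgroup _ (pow_ne_zero _ hp.ne_zero), Nat.cast_mul, Nat.cast_pow,
      ENNReal.mul_inv (by simp [h0]) (by simp), mul_pow, ENNReal.inv_pow, pow_right_comm]
  simp_rw [hterm]
  rw [ENNReal.tsum_const, ENat.card_eq_coe_natCard, ← mul_assoc, pow_succ, mul_comm (_ ^ s),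
    ← mul_assoc]
  congr 1
  change ((K.index : ℕ) : ℝ≥0∞) * _ * _ = _
  convert one_mul _
  exact ENNReal.mul_inv_cancel (by simpa using h0) (by simp)

/-- The homomorphisms from `A × ℤ` are given by a homomorphism from `A` and an element. -/
def prodIntHomEquiv (A G : Type) [CommGroup A] [CommGroup G] :
    (A × Multiplicative ℤ →* G) ≃ (A →* G) × G where
  toFun φ := (φ.comp (MonoidHom.inl _ _), φ (1, Multiplicative.ofAdd 1))
  invFun x := x.1.coprod (zpowersHom G x.2)
  left_inv φ := by
    refine MonoidHom.ext fun ⟨a, z⟩ => ?_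
    change φ (a, 1) * φ (1, Multiplicative.ofAdd 1) ^ z.toAdd = φ (a, z)
    rw [← map_zpow, ← map_mul, Prod.pow_mk, Prod.mk_mul_mk, ← ofAdd_zsmul]
    simp
  right_inv x := by
    ext <;> simp

theorem subgroupZeta_punit (p s : ℕ) : subgroupZeta p PUnit.{1} s = 1 := by
  have : Unique (PPowIndex p PUnit.{1}) :=
    { default := ⟨⊤, 0, by simp⟩
      uniq := fun H => Subtype.ext (Subsingleton.elim _ _) }
  have h : (default : PPowIndex p PUnit.{1}).1 = ⊤ := Subsingleton.elim _ _
  rw [subgroupZeta, tsum_eq_single default fun b hb => absurd (Unique.eq_default b) hb, h,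
    Subgroup.index_top, Nat.cast_one, inv_one, one_pow]

/-- A free abelian group of rank `n`, described by its homomorphisms and its subgroups. -/
theorem exists_card_hom_eq_and_subgroupZeta_eq {p : ℕ} (hp : p.Prime) (n : ℕ) :
    ∃ (F : Type) (_ : CommGroup F),
      (∀ (G : Type) [CommGroup G], Nat.card (F →* G) = Nat.card G ^ n) ∧
      ∀ k, subgroupZeta p F (n + k) = eulerProd (p : ℝ≥0∞)⁻¹ k n := by
  induction n with
  | zero =>
    refine ⟨PUnit.{1}, inferInstance, fun G _ => ?_, fun k => ?_⟩
    · have : Unique (PUnit.{1} →* G) :=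
        { default := 1, uniq := fun φ => MonoidHom.ext fun x => by
            rw [Subsingleton.elim x 1, map_one, map_one] }
      rw [Nat.card_unique, pow_zero]
    · rw [subgroupZeta_punit, eulerProd_zero_right]
  | succ n ih =>
    obtain ⟨F, _, hF, hF'⟩ := ih
    refine ⟨F × Multiplicative ℤ, inferInstance, fun G _ => ?_, fun k => ?_⟩
    · rw [Nat.card_congr (prodIntHomEquiv F G), Nat.card_prod, hF, pow_succ]
    -- Rank and exponent drop together, so k stays fixed through the induction.
    · rw [show n + 1 + k = n + k + 1 by omega, subgroupZeta_prod_int hp, hF', eulerProd_succ,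
        add_comm k n]

/-! ### Grouping subgroups by their quotient -/

/-- The quotient by a subgroup of `p`-power index. -/
def PPowIndex.quotient {p : ℕ} (hp : p.Prime) {F : Type} [CommGroup F] (H : PPowIndex p F) :
    FinAbPGroup p where
  carrier := F ⧸ H.1
  finite := Nat.finite_of_card_ne_zero <| by
    obtain ⟨e, he⟩ := H.2
    change H.1.index ≠ 0
    rw [he]
    exact pow_ne_zero _ hp.ne_zero
  isPGroup := by
    obtain ⟨e, he⟩ := H.2
    exact IsPGroup.of_card (n := e) he

/-- The isomorphism class of the quotient by a subgroup of `p`-power index. -/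
def PPowIndex.quotientClass {p : ℕ} (hp : p.Prime) {F : Type} [CommGroup F] (H : PPowIndex p F) :
    AbPClass p :=
  Quotient.mk _ (H.quotient hp)

theorem PPowIndex.order_quotientClass {p : ℕ} (hp : p.Prime) {F : Type} [CommGroup F]
    (H : PPowIndex p F) : (H.quotientClass hp).order = H.1.index := rfl

/-- The subgroups of `F` with quotient isomorphic to `G`. -/
abbrev PPowIndex.WithQuotient {p : ℕ} (hp : p.Prime) (F : Type) [CommGroup F]
    (x : AbPClass p) : Type :=
  {H : PPowIndex p F // H.quotientClass hp = x}

/-- An isomorphism of a quotient with a representative of its class. -/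
noncomputable def PPowIndex.WithQuotient.iso {p : ℕ} {hp : p.Prime} {F : Type} [CommGroup F]
    {G : FinAbPGroup p} (H : PPowIndex.WithQuotient hp F (Quotient.mk _ G)) :
    F ⧸ H.1.1 ≃* G.carrier :=
  Classical.choice (Quotient.exact H.2)

/-- The surjection with a given kernel obtained from an automorphism. -/
noncomputable def surjectionOfAut {p : ℕ} (hp : p.Prime) (F : Type) [CommGroup F]
    (G : FinAbPGroup p)
    (x : PPowIndex.WithQuotient hp F (Quotient.mk _ G) × MulAut G.carrier) :
    {φ : F →* G.carrier // Function.Surjective φ} :=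
  ⟨((x.1.iso.trans x.2 : F ⧸ x.1.1.1 ≃* G.carrier) : F ⧸ x.1.1.1 →* G.carrier).comp
      (QuotientGroup.mk' x.1.1.1),
    (x.1.iso.trans x.2).surjective.comp (QuotientGroup.mk'_surjective _)⟩

theorem surjectionOfAut_apply {p : ℕ} (hp : p.Prime) (F : Type) [CommGroup F] (G : FinAbPGroup p)
    (H : PPowIndex.WithQuotient hp F (Quotient.mk _ G)) (α : MulAut G.carrier) (y : F) :
    (surjectionOfAut hp F G (H, α)).1 y = α (H.iso (y : F ⧸ H.1.1)) := rfl

theorem ker_surjectionOfAut {p : ℕ} (hp : p.Prime) (F : Type) [CommGroup F] (G : FinAbPGroup p)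
    (H : PPowIndex.WithQuotient hp F (Quotient.mk _ G)) (α : MulAut G.carrier) :
    (surjectionOfAut hp F G (H, α)).1.ker = H.1.1 := by
  ext y
  rw [MonoidHom.mem_ker, surjectionOfAut_apply, map_eq_one_iff α α.injective,
    map_eq_one_iff _ H.iso.injective, QuotientGroup.eq_one_iff]

/-- A surjection onto G amounts to its kernel together with an identification of the quotient with
G; relative to the chosen isomorphism, the latter is an automorphism. -/
theorem surjectionOfAut_bijective {p : ℕ} (hp : p.Prime) (F : Type) [CommGroup F]
    (G : FinAbPGroup p) : Function.Bijective (surjectionOfAut hp F G) := by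
  constructor
  · rintro ⟨H, α⟩ ⟨K, β⟩ h
    have hHK : H = K := Subtype.ext (Subtype.ext (by
      rw [← ker_surjectionOfAut hp F G H α, h, ker_surjectionOfAut]))
    subst hHK
    rw [Prod.mk.injEq]
    refine ⟨rfl, MulEquiv.ext fun g => ?_⟩
    obtain ⟨y, rfl⟩ := H.iso.surjective g
    obtain ⟨y, rfl⟩ := QuotientGroup.mk_surjective y
    rw [← surjectionOfAut_apply, h, surjectionOfAut_apply]
  · rintro ⟨φ, hφ⟩
    let e := QuotientGroup.quotientKerEquivOfSurjective φ hφ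
    have hp' : Fact p.Prime := ⟨hp⟩
    obtain ⟨m, hm⟩ := G.isPGroup.exists_card_eq
    let H : PPowIndex.WithQuotient hp F (Quotient.mk _ G) :=
      ⟨⟨φ.ker, m, by rw [← hm]; exact Nat.card_congr e.toEquiv⟩, Quotient.sound ⟨e⟩⟩
    refine ⟨(H, H.iso.symm.trans e), Subtype.ext (MonoidHom.ext fun y => ?_)⟩
    rw [surjectionOfAut_apply]
    change e (H.iso.symm (H.iso _)) = _
    rw [MulEquiv.symm_apply_apply]
    rfl

/-- The number of surjections from `F` to the groups of an isomorphism class. -/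
noncomputable def AbPClass.surjCount {p : ℕ} (F : Type) [CommGroup F] (x : AbPClass p) : ℕ :=
  Quotient.lift (fun G : FinAbPGroup p => Nat.card {φ : F →* G.carrier // Function.Surjective φ})
    (by
      rintro G H ⟨e⟩
      refine Nat.card_congr (e.monoidHomCongrRightEquiv.subtypeEquiv fun φ => ?_)
      exact (EquivLike.comp_surjective φ e).symm) x

theorem AbPClass.autOrder_ne_zero {p : ℕ} (x : AbPClass p) : x.autOrder ≠ 0 := by
  induction x using Quotient.inductionOn with
  | h G =>
    have : Finite (MulAut G.carrier) := Finite.of_injective _ DFunLike.coe_injective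
    exact Nat.card_pos.ne'

theorem AbPClass.order_ne_zero {p : ℕ} (x : AbPClass p) : x.order ≠ 0 := by
  induction x using Quotient.inductionOn with
  | h G => exact Nat.card_pos.ne'

/-- The subgroups with quotient G number |Sur(F, G)| / |Aut G|. Finiteness of the set of
homomorphisms ensures that `Nat.card` gives the true counts. -/
theorem subgroupZeta_eq_tsum {p : ℕ} (hp : p.Prime) (F : Type) [CommGroup F]
    (hF : ∀ (G : Type) [CommGroup G] [Finite G], Finite (F →* G)) (s : ℕ) :
    subgroupZeta p F s = ∑' x : AbPClass p,
      (x.surjCount F : ℝ≥0∞) / x.autOrder * ((x.order : ℝ≥0∞)⁻¹) ^ s := by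
  rw [subgroupZeta, ← (Equiv.sigmaFiberEquiv (PPowIndex.quotientClass hp)).tsum_eq,
    ENNReal.tsum_sigma']
  refine tsum_congr fun x => ?_
  have hterm : ∀ H : PPowIndex.WithQuotient hp F x,
      (((Equiv.sigmaFiberEquiv (PPowIndex.quotientClass hp) ⟨x, H⟩).1.index : ℝ≥0∞)⁻¹) ^ s =
        ((x.order : ℝ≥0∞)⁻¹) ^ s := fun H => by
    change ((H.1.1.index : ℝ≥0∞)⁻¹) ^ s = _
    rw [← PPowIndex.order_quotientClass hp, H.2]
  simp_rw [hterm]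
  rw [ENNReal.tsum_const]
  congr 1
  have hcard : Nat.card (PPowIndex.WithQuotient hp F x) * x.autOrder = x.surjCount F ∧
      Finite (PPowIndex.WithQuotient hp F x) := by
    induction x using Quotient.inductionOn with
    | h G =>
      have := hF G.carrier
      have hb := surjectionOfAut_bijective hp F G
      refine ⟨?_, ?_⟩
      · exact (Nat.card_prod _ _).symm.trans (Nat.card_congr (Equiv.ofBijective _ hb))
      · have := Finite.of_injective _ hb.1
        exact Finite.of_injective (fun H => (H, (1 : MulAut G.carrier)))
          fun H K h => congrArg Prod.fst h
  have := hcard.2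
  rw [ENat.card_eq_coe_natCard, ← hcard.1, Nat.cast_mul, ENNReal.mul_div_cancel_right]
  · rfl
  · simpa using x.autOrder_ne_zero
  · simp

/-! ### The limit of large rank and the second series -/

open Filter Topology

/-- A homomorphism that is not surjective factors through its range, a proper subgroup. -/
theorem card_pow_le_card_surjective_add {F G : Type} [CommGroup F] [CommGroup G] [Finite G] {n : ℕ}
    (hF : ∀ (G : Type) [CommGroup G], Nat.card (F →* G) = Nat.card G ^ n) :
    Nat.card G ^ n ≤ Nat.card {φ : F →* G // Function.Surjective φ} +
      ∑ᶠ M : {M : Subgroup G // M ≠ ⊤}, Nat.card M.1 ^ n := by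
  have hfin : ∀ (H : Type) [CommGroup H] [Finite H], Finite (F →* H) := fun H _ _ =>
    Nat.finite_of_card_ne_zero (by rw [hF]; exact pow_ne_zero _ Nat.card_pos.ne')
  have := hfin G
  have := fun M : {M : Subgroup G // M ≠ ⊤} => hfin M.1
  let Ψ : {φ : F →* G // Function.Surjective φ} ⊕
      (Σ M : {M : Subgroup G // M ≠ ⊤}, F →* M.1) → (F →* G) :=
    Sum.elim Subtype.val fun x => x.1.1.subtype.comp x.2
  have hΨ : Function.Surjective Ψ := fun φ => by
    by_cases h : φ.range = ⊤
    · exact ⟨Sum.inl ⟨φ, MonoidHom.range_eq_top.1 h⟩, rfl⟩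
    · exact ⟨Sum.inr ⟨⟨φ.range, h⟩, φ.rangeRestrict⟩, rfl⟩
  have hle := Nat.card_le_card_of_surjective Ψ hΨ
  rw [hF, Nat.card_sum] at hle
  refine hle.trans (Nat.add_le_add_left (le_of_eq ?_) _)
  have := Fintype.ofFinite {M : Subgroup G // M ≠ ⊤}
  rw [Nat.card_sigma, finsum_eq_sum_of_fintype]
  exact Finset.sum_congr rfl fun M _ => hF M.1

theorem AbPClass.surjCount_le {p n : ℕ} {F : Type} [CommGroup F]
    (hF : ∀ (G : Type) [CommGroup G], Nat.card (F →* G) = Nat.card G ^ n) (x : AbPClass p) :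
    x.surjCount F ≤ x.order ^ n := by
  induction x using Quotient.inductionOn with
  | h G =>
    have : Finite (F →* G.carrier) :=
      Nat.finite_of_card_ne_zero (by rw [hF]; exact pow_ne_zero _ Nat.card_pos.ne')
    exact (Nat.card_le_card_of_injective Subtype.val Subtype.val_injective).trans (hF _).le

theorem AbPClass.surjCount_mul_inv_pow_le {p n : ℕ} {F : Type} [CommGroup F]
    (hF : ∀ (G : Type) [CommGroup G], Nat.card (F →* G) = Nat.card G ^ n) (x : AbPClass p) :
    (x.surjCount F : ℝ≥0∞) * (x.order : ℝ≥0∞)⁻¹ ^ n ≤ 1 := by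
  have h0 : (x.order : ℝ≥0∞) ≠ 0 := by simpa using x.order_ne_zero
  calc (x.surjCount F : ℝ≥0∞) * (x.order : ℝ≥0∞)⁻¹ ^ n
      ≤ (x.order : ℝ≥0∞) ^ n * (x.order : ℝ≥0∞)⁻¹ ^ n := by
        gcongr; exact_mod_cast x.surjCount_le hF
    _ = 1 := by rw [← mul_pow, ENNReal.mul_inv_cancel h0 (by simp), one_pow]

/-- Almost all homomorphisms from a free abelian group of large rank to a given group are
surjective. -/
theorem AbPClass.tendsto_surjCount_mul_inv_pow {p : ℕ} {F : ℕ → Type} [∀ n, CommGroup (F n)]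
    (hF : ∀ (n : ℕ) (G : Type) [CommGroup G], Nat.card (F n →* G) = Nat.card G ^ n)
    (x : AbPClass p) :
    Tendsto (fun n => (x.surjCount (F n) : ℝ≥0∞) * (x.order : ℝ≥0∞)⁻¹ ^ n) atTop (𝓝 1) := by
  have hle := fun n => x.surjCount_mul_inv_pow_le (hF n)
  have h0 : (x.order : ℝ≥0∞) ≠ 0 := by simpa using x.order_ne_zero
  induction x using Quotient.inductionOn with
  | h G =>
    set c : ℝ≥0∞ := (AbPClass.order (p := p) (Quotient.mk _ G) : ℝ≥0∞) with hc
    have hcG : c = (Nat.card G.carrier : ℝ≥0∞) := rfl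
    have := Fintype.ofFinite {M : Subgroup G.carrier // M ≠ ⊤}
    -- Each of the finitely many proper subgroups M contributes (|M|/|G|)^n, which tends to 0.
    have hδ : Tendsto (fun n => ∑ M : {M : Subgroup G.carrier // M ≠ ⊤},
        ((Nat.card M.1 : ℝ≥0∞) * c⁻¹) ^ n) atTop (𝓝 0) := by
      rw [← Finset.sum_const_zero (ι := {M : Subgroup G.carrier // M ≠ ⊤}) (s := Finset.univ)]
      refine tendsto_finsetSum _ fun M _ => ?_
      refine ENNReal.tendsto_pow_atTop_nhds_zero_of_lt_one ?_
      rw [← div_eq_mul_inv, ENNReal.div_lt_iff (Or.inl h0) (Or.inl (by simp [hc])), one_mul, hcG]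
      exact_mod_cast lt_of_le_of_ne (Subgroup.card_le_card_group M.1)
        fun h => M.2 (Subgroup.eq_top_of_card_eq M.1 h)
    have hlow : Tendsto (fun n => 1 - ∑ M : {M : Subgroup G.carrier // M ≠ ⊤},
        ((Nat.card M.1 : ℝ≥0∞) * c⁻¹) ^ n) atTop (𝓝 1) := by
      simpa using ENNReal.Tendsto.sub tendsto_const_nhds hδ (Or.inl ENNReal.one_ne_top)
    refine tendsto_of_tendsto_of_tendsto_of_le_of_le hlow tendsto_const_nhds (fun n => ?_) hle
    have h := card_pow_le_card_surjective_add (G := G.carrier) (hF n)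
    rw [finsum_eq_sum_of_fintype] at h
    rw [tsub_le_iff_right]
    calc (1 : ℝ≥0∞) = c ^ n * c⁻¹ ^ n := by
          rw [← mul_pow, ENNReal.mul_inv_cancel h0 (by simp [hc]), one_pow]
      _ ≤ ((Nat.card {φ : F n →* G.carrier // Function.Surjective φ} : ℝ≥0∞) +
          ∑ M : {M : Subgroup G.carrier // M ≠ ⊤}, (Nat.card M.1 : ℝ≥0∞) ^ n) * c⁻¹ ^ n := by
          gcongr
          rw [hcG]
          exact_mod_cast h
      _ = _ := by
          rw [add_mul, Finset.sum_mul]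
          simp_rw [← mul_pow]
          rfl

/-- The terms `f n x` are at most `w x` and converge to it. The bound gives one inequality; Fatou's
lemma gives the other without any monotonicity in n. -/
theorem AbPClass.tsum_inv_autOrder_mul {p : ℕ} (hp : p.Prime) (k : ℕ) :
    ∑' x : AbPClass p, (x.autOrder : ℝ≥0∞)⁻¹ * (x.order : ℝ≥0∞)⁻¹ ^ k =
      ⨆ N, eulerProd (p : ℝ≥0∞)⁻¹ k N := by
  choose F inst hF hζ using exists_card_hom_eq_and_subgroupZeta_eq hp
  have hfin : ∀ n (G : Type) [CommGroup G] [Finite G], Finite (F n →* G) := fun n G _ _ =>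
    Nat.finite_of_card_ne_zero (by rw [hF]; exact pow_ne_zero _ Nat.card_pos.ne')
  set w : AbPClass p → ℝ≥0∞ := fun x => (x.autOrder : ℝ≥0∞)⁻¹ * (x.order : ℝ≥0∞)⁻¹ ^ k with hw
  let f : ℕ → AbPClass p → ℝ≥0∞ := fun n x =>
    ((x.surjCount (F n) : ℝ≥0∞) * (x.order : ℝ≥0∞)⁻¹ ^ n) * w x
  have hsum : ∀ n, ∑' x, f n x = eulerProd (p : ℝ≥0∞)⁻¹ k n := fun n => by
    rw [← hζ n k, subgroupZeta_eq_tsum hp (F n) (hfin n)]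
    refine tsum_congr fun x => ?_
    simp only [f, hw]
    rw [pow_add, div_eq_mul_inv]
    ring
  apply le_antisymm
  -- With the discrete σ-algebra every function is measurable, and integrals against counting
  -- measure are sums.
  · let _ : MeasurableSpace (AbPClass p) := ⊤
    have hlim : ∀ x, liminf (fun n => f n x) atTop = w x := fun x => by
      refine Tendsto.liminf_eq ?_
      have hwx : w x ≠ ∞ := by
        refine ENNReal.mul_ne_top ?_ (ENNReal.pow_ne_top ?_)
        · simpa using x.autOrder_ne_zero
        · simpa using x.order_ne_zero
      simpa using ENNReal.Tendsto.mul_const (x.tendsto_surjCount_mul_inv_pow hF) (Or.inr hwx)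
    have hfatou := MeasureTheory.lintegral_liminf_le (μ := MeasureTheory.Measure.count)
      (u := atTop) (f := f) fun n => measurable_from_top
    simp_rw [MeasureTheory.lintegral_count, hlim, hsum] at hfatou
    rwa [(tendsto_atTop_iSup (eulerProd_mono _ k)).liminf_eq] at hfatou
  · refine iSup_le fun n => ?_
    rw [← hsum n]
    exact ENNReal.tsum_le_tsum fun x => mul_le_of_le_one_left' (x.surjCount_mul_inv_pow_le (hF n))

/-! ### Return to real series -/

theorem prod_mul_toReal_eulerProd {p : ℕ} (hp : p.Prime) (k : ℕ) :
    (∏ j ∈ Finset.Icc 1 k, (1 - 1 / (p : ℝ) ^ j)) * (eulerProd (p : ℝ≥0∞)⁻¹ 0 k).toReal = 1 := by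
  rw [eulerProd, ENNReal.toReal_prod, Finset.range_eq_Ico, ← Finset.Ico_add_one_right_eq_Icc,
    Finset.prod_Ico_eq_prod_range, Finset.range_eq_Ico, Nat.add_sub_cancel,
    ← Finset.prod_mul_distrib]
  refine Finset.prod_eq_one fun j _ => ?_
  have hp1 : (1 : ℝ) < p := by exact_mod_cast hp.one_lt
  have h1 : (1 : ℝ) < (p : ℝ) ^ (1 + j) := one_lt_pow₀ hp1 (by omega)
  have h2 : ((p : ℝ≥0∞)⁻¹) ^ (1 + j) ≤ 1 :=
    pow_le_one₀ zero_le (ENNReal.inv_le_one.2 (by exact_mod_cast hp.one_le))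
  rw [zero_add, ENNReal.toReal_inv, ENNReal.toReal_sub_of_le h2 ENNReal.one_ne_top,
    ENNReal.toReal_one, ENNReal.toReal_pow, ENNReal.toReal_inv, ENNReal.toReal_natCast, inv_pow,
    ← one_div ((p : ℝ) ^ _)]
  refine mul_inv_cancel₀ (sub_ne_zero.2 (ne_of_gt ?_))
  rw [div_lt_one (by positivity)]
  exact h1

theorem mainTheorem2 (p : ℕ) (hp : p.Prime) (k : ℕ) :
    Summable (fun x : AbPClass.firstIso p (k + 1) => 1 / (x.1.order : ℝ)) ∧
    Summable (fun x : AbPClass p => 1 / ((x.order : ℝ) ^ k * (x.autOrder : ℝ))) ∧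
    Summable (fun x : AbPClass p => 1 / (x.order : ℝ)) ∧
    (∑' x : AbPClass.firstIso p (k + 1), 1 / (x.1.order : ℝ)) =
      ∑' x : AbPClass p, 1 / ((x.order : ℝ) ^ k * (x.autOrder : ℝ)) ∧
    (∑' x : AbPClass p, 1 / ((x.order : ℝ) ^ k * (x.autOrder : ℝ))) =
      (∏ j ∈ Finset.Icc 1 k, (1 - 1 / (p : ℝ) ^ j)) * ∑' x : AbPClass p, 1 / (x.order : ℝ) := by
  have hq : (p : ℝ≥0∞)⁻¹ ≤ 2⁻¹ := ENNReal.inv_le_inv.2 (by exact_mod_cast hp.two_le)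
  have e1 := AbPClass.tsum_firstIso hp k
  have e2 := AbPClass.tsum_inv_autOrder_mul hp k
  have e3 := AbPClass.tsum_order_inv hp
  have t := fun k => iSup_eulerProd_ne_top hq k
  have r1 : (fun x : AbPClass.firstIso p (k + 1) => 1 / (x.1.order : ℝ)) =
      fun x => ((x.1.order : ℝ≥0∞)⁻¹).toReal := by
    funext x; simp
  have r2 : (fun x : AbPClass p => 1 / ((x.order : ℝ) ^ k * (x.autOrder : ℝ))) =
      fun x => ((x.autOrder : ℝ≥0∞)⁻¹ * (x.order : ℝ≥0∞)⁻¹ ^ k).toReal := by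
    funext x; simp
  have r3 : (fun x : AbPClass p => 1 / (x.order : ℝ)) =
      fun x => ((x.order : ℝ≥0∞)⁻¹).toReal := by
    funext x; simp
  -- Finiteness is what makes `toReal` commute with the sums, since `toReal` sends ∞ to 0.
  have s1 : ∑' x : AbPClass.firstIso p (k + 1), ((x.1.order : ℝ≥0∞)⁻¹) ≠ ∞ := e1 ▸ t k
  have s2 : ∑' x : AbPClass p, (x.autOrder : ℝ≥0∞)⁻¹ * (x.order : ℝ≥0∞)⁻¹ ^ k ≠ ∞ := e2 ▸ t k
  have s3 : ∑' x : AbPClass p, (x.order : ℝ≥0∞)⁻¹ ≠ ∞ := e3 ▸ t 0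
  rw [r1, r2, r3]
  refine ⟨ENNReal.summable_toReal s1, ENNReal.summable_toReal s2, ENNReal.summable_toReal s3, ?_⟩
  rw [← ENNReal.tsum_toReal_eq (ENNReal.ne_top_of_tsum_ne_top s1),
    ← ENNReal.tsum_toReal_eq (ENNReal.ne_top_of_tsum_ne_top s2),
    ← ENNReal.tsum_toReal_eq (ENNReal.ne_top_of_tsum_ne_top s3), e1, e2, e3,
    iSup_eulerProd_zero _ k, ENNReal.toReal_mul, ← mul_assoc, prod_mul_toReal_eulerProd hp, one_mul]
  exact ⟨rfl, rfl⟩
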